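/- A \emph{Lie category} is a small category with set of arrows $\mathcal C$ and set of objects $\mathcal X$, where $\mathcal C$ is a smooth manifold with or without boundary and $\mathcal X$ is a smooth manifold without boundary (both finite-dimensional, Hausdorff, second countable, of constant dimension), such that: the source and target maps $s,t\colon\mathcal C\to\mathcal X$ are smooth submersions; the unit map $u\colon\mathcal X\to\mathcal C$, $x\mapsto 1_x$, and the composition map $(g,h)\mapsto gh$, defined on the submanifold of pairs $(g,h)\in\mathcal C\times\mathcal C$ with $s(g)=t(h)$, are smooth; and the restrictions of $s$ and $t$ to the boundary $\partial\mathcal C$ are submersions. It has a \emph{normal boundary} if either $u(\mathcal X)\subset\operatorname{Int}\mathcal C$, or $u(\mathcal X)\subset\partial\mathcal C$ and $\partial\mathcal C$ is closed under composition. The fibres $\mathcal C_x=s^{-1}(x)$ and $\mathcal C^x=t^{-1}(x)$ are submanifolds of $\mathcal C$, with tangent spaces $T_h\mathcal C_x=\ker \mathrm d s_h$ and $T_h\mathcal C^x=\ker \mathrm d t_h$. For $g\in\mathcal C$ let $$L_g\colon\mathcal C^{s(g)}\to\mathcal C^{t(g)},\ L_g(h)=gh,\qquad R_g\colon\mathcal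 C_{t(g)}\to\mathcal C_{s(g)},\ R_g(h)=hg,$$ and define the left and right rank of $g$ by $$\operatorname{rank}^L(g)=\operatorname{rank}\mathrm d(L_g)_{1_{s(g)}},\qquad \operatorname{rank}^R(g)=\operatorname{rank}\mathrm d(R_g)_{1_{t(g)}}.$$ Let $\mathcal G(\mathcal C)\subset\mathcal C$ be the set of invertible arrows, and put $\mathcal G(\mathcal C)^x=\mathcal G(\mathcal C)\cap\mathcal C^x$, $\mathcal G(\mathcal C)_x=\mathcal G(\mathcal C)\cap\mathcal C_x$. \textbf{Corollary.} Let $\mathcal C$ be a Lie category with a normal boundary. For every $g\in\mathcal C$, $$\operatorname{rank}^L(g)=\operatorname{rank}\mathrm d(L_g)_h\quad\text{for every } h\in\mathcal G(\mathcal C)^{s(g)},$$ $$\operatorname{rank}^R(g)=\operatorname{rank}\mathrm d(R_g)_h\quad\text{for every } h\in\mathcal G(\mathcal C)_{t(g)}.$$ -/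

import Mathlib

open Set Function
open scoped Manifold ContDiff

/-- A small category given by its set `C` of arrows and its set `X` of objects: source `s`,
target `t`, units `u`, and composition `comp g h = gh`, which is meaningful only for composable
pairs, i.e. when `s g = t h`; its values at other pairs are irrelevant and never used. -/
structure ArrowCategory (C X : Type*) where
  s : C → X
  t : C → X
  u : X → C
  comp : C → C → C
  s_u : ∀ x, s (u x) = x
  t_u : ∀ x, t (u x) = x
  s_comp : ∀ g h, s g = t h → s (comp g h) = s h
  t_comp : ∀ g h, s g = t h → t (comp g h) = t g
  comp_u : ∀ g, comp g (u (s g)) = g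
  u_comp : ∀ g, comp (u (t g)) g = g
  assoc : ∀ g h k, s g = t h → s h = t k → comp (comp g h) k = comp g (comp h k)

namespace ArrowCategory

section Algebra

variable {C X : Type*} (𝒞 : ArrowCategory C X)

/-- The set of composable pairs. -/
def composable : Set (C × C) := {p | 𝒞.s p.1 = 𝒞.t p.2}

/-- The source fibre at `x`: all arrows with source `x`. -/
def sourceFibre (x : X) : Set C := {g | 𝒞.s g = x}

/-- The target fibre at `x`: all arrows with target `x`. -/
def targetFibre (x : X) : Set C := {g | 𝒞.t g = x}

/-- The core: the set of invertible arrows. -/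
def core : Set C :=
  {g | ∃ k, 𝒞.s k = 𝒞.t g ∧ 𝒞.t k = 𝒞.s g ∧
    𝒞.comp k g = 𝒞.u (𝒞.s g) ∧ 𝒞.comp g k = 𝒞.u (𝒞.t g)}

/-- Left translation `h ↦ gh`, to be considered on the target fibre at `s g` only. -/
def leftTranslation (g : C) : C → C := fun h => 𝒞.comp g h

/-- Right translation `h ↦ hg`, to be considered on the source fibre at `t g` only. -/
def rightTranslation (g : C) : C → C := fun h => 𝒞.comp h g

end Algebra

end ArrowCategory

/-- The model `I` describes manifolds with or without boundary: its range is `{v | 0 ≤ ℓ v}`,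
which is a closed half-space if `ℓ ≠ 0` and the whole vector space if `ℓ = 0`. -/
def IsBoundaryModel {E H : Type*} [NormedAddCommGroup E] [NormedSpace ℝ E] [TopologicalSpace H]
    (I : ModelWithCorners ℝ E H) (ℓ : E →L[ℝ] ℝ) : Prop :=
  range I = {v : E | 0 ≤ ℓ v}

/-- For a model with range `{v | 0 ≤ ℓ v}` and a boundary point `p` of `M`: the tangent space at `p`
of the boundary of `M`, a subspace of the tangent space of `M` at `p`. In the preferred chart at
`p`, through which the tangent space at `p` is identified with `E`, the boundary is given by
`ℓ = 0`. -/
noncomputable def boundaryTangentSpace {E H M : Type*} [NormedAddCommGroup E] [NormedSpace ℝ E]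
    [TopologicalSpace H] (I : ModelWithCorners ℝ E H) (ℓ : E →L[ℝ] ℝ)
    [TopologicalSpace M] [ChartedSpace H M] (p : M) : Submodule ℝ (TangentSpace I p) :=
  LinearMap.ker (ℓ : E →ₗ[ℝ] ℝ)

namespace ArrowCategory

section Smooth

variable {E H F K C X : Type*}
  [NormedAddCommGroup E] [NormedSpace ℝ E] [TopologicalSpace H]
  [NormedAddCommGroup F] [NormedSpace ℝ F] [TopologicalSpace K]
  [TopologicalSpace C] [ChartedSpace H C] [TopologicalSpace X] [ChartedSpace K X]

/-- Lie categories, on smooth manifolds `C` (arrows, with or without boundary) and `X` (objects,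
without boundary): `s` and `t` are smooth submersions, units and composition are smooth, and the
restrictions of `s` and `t` to the boundary of `C` are submersions (regular boundary; this says
nothing if the boundary is empty). The set of composable pairs is a submanifold (with corners) of
`C × C`, so smoothness of a map on it is smoothness within this subset of `C × C`. -/
structure IsLieCategory (I : ModelWithCorners ℝ E H) (ℓ : E →L[ℝ] ℝ) (J : ModelWithCorners ℝ F K)
    (𝒞 : ArrowCategory C X) : Prop where
  smooth_s : ContMDiff I J ∞ 𝒞.s
  smooth_t : ContMDiff I J ∞ 𝒞.t
  submersion_s : ∀ g, Surjective (mfderiv I J 𝒞.s g)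
  submersion_t : ∀ g, Surjective (mfderiv I J 𝒞.t g)
  smooth_u : ContMDiff J I ∞ 𝒞.u
  smooth_comp : ContMDiffOn (I.prod I) I ∞ (fun p : C × C => 𝒞.comp p.1 p.2) 𝒞.composable
  boundary_submersion_s : ∀ g ∈ I.boundary C, ∀ w : TangentSpace J (𝒞.s g),
    ∃ v ∈ boundaryTangentSpace I ℓ g, mfderiv I J 𝒞.s g v = w
  boundary_submersion_t : ∀ g ∈ I.boundary C, ∀ w : TangentSpace J (𝒞.t g),
    ∃ v ∈ boundaryTangentSpace I ℓ g, mfderiv I J 𝒞.t g v = w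

/-- Normal boundary: all units lie in the interior, or the boundary is a wide subcategory
(it contains all units and is closed under composition). -/
def HasNormalBoundary (I : ModelWithCorners ℝ E H) (𝒞 : ArrowCategory C X) : Prop :=
  (∀ x, 𝒞.u x ∈ I.interior C) ∨
  ((∀ x, 𝒞.u x ∈ I.boundary C) ∧
    ∀ g ∈ I.boundary C, ∀ h ∈ I.boundary C, 𝒞.s g = 𝒞.t h → 𝒞.comp g h ∈ I.boundary C)

/-- The differential at `h` of the left translation by `g`, a map from the target fibre at `s g`
to the target fibre at `t g`. It is defined on the tangent space at `h` of the
target fibre, which is the kernel of `dt` at `h`. (A derivative of a function within the fibre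
is determined by the function only in the directions tangent to the fibre, whence the
restriction to this subspace.) -/
noncomputable def leftDifferential (I : ModelWithCorners ℝ E H) (J : ModelWithCorners ℝ F K)
    (𝒞 : ArrowCategory C X) (g h : C) :
    LinearMap.ker (mfderiv I J 𝒞.t h).toLinearMap →ₗ[ℝ] TangentSpace I (𝒞.leftTranslation g h) :=
  (mfderivWithin I I (𝒞.leftTranslation g) (𝒞.targetFibre (𝒞.s g)) h).toLinearMap.domRestrict _

/-- The differential at `h` of the right translation by `g`, a map from the source fibre at `t g`
to the source fibre at `s g`; defined on the kernel of `ds` at `h`, the tangent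
space at `h` of the source fibre. -/
noncomputable def rightDifferential (I : ModelWithCorners ℝ E H) (J : ModelWithCorners ℝ F K)
    (𝒞 : ArrowCategory C X) (g h : C) :
    LinearMap.ker (mfderiv I J 𝒞.s h).toLinearMap →ₗ[ℝ] TangentSpace I (𝒞.rightTranslation g h) :=
  (mfderivWithin I I (𝒞.rightTranslation g) (𝒞.sourceFibre (𝒞.t g)) h).toLinearMap.domRestrict _

/-- The left rank of `g`: the rank of the differential of left translation by `g` at the unit. -/
noncomputable def leftRank (I : ModelWithCorners ℝ E H) (J : ModelWithCorners ℝ F K)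
    (𝒞 : ArrowCategory C X) (g : C) : ℕ :=
  Module.finrank ℝ (LinearMap.range (𝒞.leftDifferential I J g (𝒞.u (𝒞.s g))))

/-- The right rank of `g`: the rank of the differential of right translation by `g` at the unit. -/
noncomputable def rightRank (I : ModelWithCorners ℝ E H) (J : ModelWithCorners ℝ F K)
    (𝒞 : ArrowCategory C X) (g : C) : ℕ :=
  Module.finrank ℝ (LinearMap.range (𝒞.rightDifferential I J g (𝒞.u (𝒞.t g))))

end Smooth

end ArrowCategory

/-! Let `t h = s g`. If `v` in `ker dt` at `h` is killed by `d(L_g)_h`, then differentiating `s(gh)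
= s(h)` gives `ds v = 0`, so right translation applies to `v`. For `k` with `s h = t k`,
associativity `g(hk) = (gh)k` sends `v` to a vector `v·k` in the kernel of `d(L_g)_{hk}`, and a
right inverse of `k` makes `v ↦ v·k` injective. Applied with `k = h` at the unit and with `k = h⁻¹`
at `h`, this makes the two nullities equal. Since `t` is a submersion, all spaces `ker dt` have the
same dimension, and rank-nullity gives equal ranks (`finrank_ker_leftMap_le`,
`finrank_range_leftDifferential`).

The work lies in differentiating the category laws on composable pairs and triples, where arrows may
lie on the boundary. Tangent vectors are represented by sequences with a velocity at scale `1/n`, so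
that a law between sequences passes to velocities. Vectors pointing strictly inward have such
sequences, which lift through submersions (`PointsInward.exists_lift`). Regularity of the boundary
supplies inward composable tangent triples. Adding a large multiple of one to any composable triple
makes it inward, so a linear identity valid for inward triples holds for all
(`eq_zero_of_composable_triple`). -/

open Filter Topology Metric
open scoped NNReal

/-! ### Calculus at points of a convex set or half-space -/

section Analysis

variable {E F : Type*} [NormedAddCommGroup E] [NormedSpace ℝ E]
  [NormedAddCommGroup F] [NormedSpace ℝ F]

/-- A `C^1` function on a convex set is approximated by its derivative near each point. -/
theorem ContDiffWithinAt.exists_approximatesLinearOn {f : E → F} {Q : Set E} {x : E}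
    {A : E →L[ℝ] F} (hf : ContDiffWithinAt ℝ 1 f Q x) (hQ : Convex ℝ Q) (hx : x ∈ Q)
    (hU : UniqueDiffWithinAt ℝ Q x) (hA : HasFDerivWithinAt f A Q x) {c : ℝ≥0} (hc : 0 < c) :
    ∃ r > 0, ApproximatesLinearOn f A (ball x r ∩ Q) c := by
  have hg : ContDiffWithinAt ℝ 1 (fun y => f y - A y) Q x :=
    hf.sub A.contDiff.contDiffWithinAt
  have hgA : HasFDerivWithinAt (fun y => f y - A y) (0 : E →L[ℝ] F) Q x := by
    have := hA.sub (A.hasFDerivWithinAt (s := Q) (x := x))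
    rw [sub_self] at this
    exact this
  rcases hg 1 le_rfl with ⟨t, hst, p, hp⟩
  rcases Metric.mem_nhdsWithin_iff.mp hst with ⟨ε, ε0, hε⟩
  rw [insert_eq_of_mem hx] at hε
  replace hp := hp.mono hε
  have hxm : x ∈ ball x ε ∩ Q := ⟨mem_ball_self ε0, hx⟩
  rw [← insert_eq_of_mem hxm] at hp
  have hd : HasFDerivWithinAt (fun y => f y - A y)
      (continuousMultilinearCurryFin1 ℝ E F (p x 1)) (ball x ε ∩ Q) x :=
    (hp.hasFDerivWithinAt one_ne_zero (mem_insert _ _)).mono (subset_insert _ _)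
  -- Uniqueness of the derivative identifies the linear Taylor coefficient of `f - A` at `x` as
  -- zero, so any `c > 0` is a Lipschitz constant nearby.
  have hU' : UniqueDiffWithinAt ℝ (ball x ε ∩ Q) x := by
    rw [inter_comm]; exact hU.inter (ball_mem_nhds _ ε0)
  have h0 := hU'.eq hd (hgA.mono inter_subset_right)
  have hp0 : p x 1 = 0 := by simpa using h0
  obtain ⟨u, hu, hL⟩ := hp.exists_lipschitzOnWith_of_nnnorm_lt
    ((convex_ball _ _).inter hQ) c (by simpa [hp0] using hc)
  rw [inter_comm, ← nhdsWithin_restrict' _ (Metric.ball_mem_nhds _ ε0)] at hu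
  obtain ⟨r, r0, hr⟩ := Metric.mem_nhdsWithin_iff.mp hu
  refine ⟨r, r0, fun y hy z hz => ?_⟩
  have := hL.dist_le_mul y (hr hy) z (hr hz)
  rw [dist_eq_norm, dist_eq_norm] at this
  rwa [sub_sub_sub_comm, ← map_sub] at this

theorem tendsto_of_tendsto_natCast_smul_sub {x : ℕ → E} {x₀ v : E}
    (h : Tendsto (fun n : ℕ => (n : ℝ) • (x n - x₀)) atTop (𝓝 v)) : Tendsto x atTop (𝓝 x₀) := by
  have h1 : Tendsto (fun n : ℕ => ((n : ℝ)⁻¹) • ((n : ℝ) • (x n - x₀))) atTop (𝓝 ((0 : ℝ) • v)) :=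
    (tendsto_inv_atTop_zero.comp tendsto_natCast_atTop_atTop).smul h
  rw [zero_smul] at h1
  have h2 : Tendsto (fun n => x n - x₀) atTop (𝓝 0) := by
    refine h1.congr' ?_
    filter_upwards [eventually_ge_atTop 1] with n hn
    rw [inv_smul_smul₀]
    exact_mod_cast (by omega : n ≠ 0)
  simpa using h2.add_const x₀

/-- A sequence in the target of a submersion can be lifted to a sequence with a given tangent
vector pointing into the domain. -/
theorem exists_lift_of_tendsto [CompleteSpace E] [CompleteSpace F] {f : E → F} {Q : Set E} {x₀ : E}
    {A : E →L[ℝ] F} (hf : ContDiffWithinAt ℝ 1 f Q x₀) (hQ : Convex ℝ Q) (hx : x₀ ∈ Q)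
    (hU : UniqueDiffWithinAt ℝ Q x₀) (hA : HasFDerivWithinAt f A Q x₀) (hs : Surjective A)
    {v : E} {r₀ : ℝ} (hr₀ : 0 < r₀)
    (hv : ∀ᶠ n : ℕ in atTop, closedBall (x₀ + (n : ℝ)⁻¹ • v) ((n : ℝ)⁻¹ * r₀) ⊆ Q)
    {y : ℕ → F} (hy : Tendsto (fun n : ℕ => (n : ℝ) • (y n - f x₀)) atTop (𝓝 (A v))) :
    ∃ x : ℕ → E, Tendsto (fun n : ℕ => (n : ℝ) • (x n - x₀)) atTop (𝓝 v) ∧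
      ∀ᶠ n in atTop, x n ∈ Q ∧ f (x n) = y n := by
  obtain ⟨R, hR⟩ := A.exists_nonlinearRightInverse_of_surjective
    (LinearMap.range_eq_top.2 hs)
  -- Half the admissible error: a closed ball of radius `ρ` then covers one of radius `(‖R‖⁻¹ - c) ρ
  -- = c ρ` about the image of its centre.
  set c : ℝ≥0 := R.nnnorm⁻¹ / 2 with hc
  have hc0 : 0 < c := by positivity
  obtain ⟨r, r0, hr⟩ := hf.exists_approximatesLinearOn hQ hx hU hA hc0
  have hcR : ((R.nnnorm : ℝ)⁻¹ - c) = c := by rw [hc]; push_cast; ring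
  set b : ℕ → E := fun n => x₀ + (n : ℝ)⁻¹ • v with hb
  have hn0 : ∀ᶠ n : ℕ in atTop, (0 : ℝ) < n := by
    filter_upwards [eventually_ge_atTop 1] with n hn
    exact_mod_cast hn
  have hbv : Tendsto (fun n : ℕ => (n : ℝ) • (b n - x₀)) atTop (𝓝 v) := by
    refine tendsto_const_nhds.congr' ?_
    filter_upwards [hn0] with n hn
    simp only [hb, add_sub_cancel_left]
    rw [smul_inv_smul₀ hn.ne']
  have hbx := tendsto_of_tendsto_natCast_smul_sub hbv
  have hbQ : ∀ᶠ n in atTop, b n ∈ Q := by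
    filter_upwards [hv, hn0] with n h hn
    exact h (mem_closedBall_self (by positivity))
  have hfb : Tendsto (fun n : ℕ => (n : ℝ) • (f (b n) - f x₀)) atTop (𝓝 (A v)) := by
    have := hA.lim (c := fun n : ℕ => (n : ℝ)) (d := fun n => b n - x₀) (v := v)
      (by simpa using hbx.sub_const x₀) (by simpa using hbQ) hbv
    simpa using this
  set δ : ℕ → F := fun n => (n : ℝ) • (y n - f (b n)) with hδ
  have hδ0 : Tendsto δ atTop (𝓝 0) := by
    have := hy.sub hfb
    rw [sub_self] at this
    refine this.congr fun n => ?_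
    rw [hδ, ← smul_sub]; congr 1; abel
  -- Radius `ε n / n` about `b n` is just enough to reach `y n`; as `ε n → 0`, the correction does
  -- not change the velocity.
  set ε : ℕ → ℝ := fun n => (c : ℝ)⁻¹ * ‖δ n‖ with hε
  have hε0 : Tendsto ε atTop (𝓝 0) := by
    simpa using hδ0.norm.const_mul (c : ℝ)⁻¹
  have hεn : Tendsto (fun n : ℕ => (n : ℝ)⁻¹ * ε n) atTop (𝓝 0) := by
    simpa using (tendsto_inv_atTop_zero.comp tendsto_natCast_atTop_atTop).mul hε0
  have hsub : ∀ᶠ n : ℕ in atTop, closedBall (b n) ((n : ℝ)⁻¹ * ε n) ⊆ ball x₀ r ∩ Q := by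
    filter_upwards [hv, hn0, hε0.eventually_le_const hr₀,
      hεn.eventually_lt_const (half_pos r0), hbx.eventually (ball_mem_nhds x₀ (half_pos r0))]
      with n h1 h2 h3 h4 h5
    refine subset_inter (fun z hz => ?_) (Subset.trans (closedBall_subset_closedBall ?_) h1)
    · rw [mem_closedBall] at hz
      rw [mem_ball]
      linarith [dist_triangle z (b n) x₀]
    · gcongr
  have hex : ∀ᶠ n : ℕ in atTop, ∃ z ∈ closedBall (b n) ((n : ℝ)⁻¹ * ε n), z ∈ Q ∧ f z = y n := by
    filter_upwards [hsub, hn0] with n h1 h2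
    have hS := hr.surjOn_closedBall_of_nonlinearRightInverse R (by positivity) h1
    obtain ⟨z, hz, hzy⟩ := hS (show y n ∈ _ by
      rw [mem_closedBall, dist_eq_norm, hcR]
      show _ ≤ (c : ℝ) * ((n : ℝ)⁻¹ * ((c : ℝ)⁻¹ * ‖δ n‖))
      have : ‖δ n‖ = n * ‖y n - f (b n)‖ := by rw [hδ, norm_smul, Real.norm_of_nonneg h2.le]
      rw [this]
      apply le_of_eq
      have : (c : ℝ) ≠ 0 := by positivity
      field_simp)
    exact ⟨z, hz, (h1 hz).2, hzy⟩
  choose! x hx using fun (n : ℕ) (h : ∃ z ∈ closedBall (b n) ((n : ℝ)⁻¹ * ε n), z ∈ Q ∧ f z = y n)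
    => h
  refine ⟨x, ?_, hex.mono fun n h => (hx n h).2⟩
  have hd : Tendsto (fun n : ℕ => (n : ℝ) • (x n - b n)) atTop (𝓝 0) := by
    refine squeeze_zero_norm' ?_ hε0
    filter_upwards [hex, hn0] with n h hn
    have := (hx n h).1
    rw [mem_closedBall, dist_eq_norm] at this
    rw [norm_smul, Real.norm_of_nonneg hn.le]
    calc (n : ℝ) * ‖x n - b n‖ ≤ n * ((n : ℝ)⁻¹ * ε n) := by gcongr
      _ = ε n := by field_simp
  have := hd.add hbv
  rw [zero_add] at this
  refine this.congr fun n => ?_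
  rw [← smul_add]; congr 1; abel

/-- `v` points strictly into `{v | 0 ≤ ℓ v}` at `x`. -/
def PointsInward (ℓ : E →L[ℝ] ℝ) (x v : E) : Prop := ℓ x = 0 → ℓ ≠ 0 → 0 < ℓ v

theorem PointsInward.exists_closedBall_subset {ℓ : E →L[ℝ] ℝ} {x v : E} (h : PointsInward ℓ x v)
    (hx : 0 ≤ ℓ x) : ∃ r > 0, ∀ᶠ n : ℕ in atTop,
      closedBall (x + (n : ℝ)⁻¹ • v) ((n : ℝ)⁻¹ * r) ⊆ {v : E | 0 ≤ ℓ v} := by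
  have key : ∀ (r : ℝ) (n : ℕ) z, 0 < n → z ∈ closedBall (x + (n : ℝ)⁻¹ • v) ((n : ℝ)⁻¹ * r) →
      ℓ x + (n : ℝ)⁻¹ * (ℓ v - ‖ℓ‖ * r) ≤ ℓ z := by
    intro r n z hn hz
    rw [mem_closedBall, dist_eq_norm] at hz
    have h1 := ℓ.le_opNorm (z - (x + (n : ℝ)⁻¹ • v))
    have h2 := (abs_le.1 (Real.norm_eq_abs _ ▸ h1)).1
    simp only [map_sub, map_add, map_smul, smul_eq_mul] at h2
    have h3 := mul_le_mul_of_nonneg_left hz (norm_nonneg ℓ)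
    linarith
  by_cases hℓ : ℓ = 0
  · exact ⟨1, one_pos, by simp [hℓ]⟩
  rcases hx.eq_or_lt with h0 | h0
  · have hv := h h0.symm hℓ
    have hn : 0 < ‖ℓ‖ := norm_pos_iff.2 hℓ
    refine ⟨ℓ v / ‖ℓ‖, by positivity, ?_⟩
    filter_upwards [eventually_gt_atTop 0] with n hn z hz
    have := key _ n z hn hz
    rw [mul_div_cancel₀ _ (by positivity), sub_self, ← h0] at this
    simpa using this
  · refine ⟨1, one_pos, ?_⟩
    have : Tendsto (fun n : ℕ => ℓ x + (n : ℝ)⁻¹ * (ℓ v - ‖ℓ‖ * 1)) atTop (𝓝 (ℓ x + 0 * _)) :=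
      tendsto_const_nhds.add
        ((tendsto_inv_atTop_zero.comp tendsto_natCast_atTop_atTop).mul_const _)
    filter_upwards [eventually_gt_atTop 0, this.eventually_const_lt (by simpa using h0)]
      with n hn h z hz
    exact (h.trans_le (key _ n z hn hz)).le

/-- Supplies the domination hypothesis of `LinearMap.eq_zero_of_eventually`. -/
theorem PointsInward.eventually_add_smul {ℓ : E →L[ℝ] ℝ} {x v : E} (h : PointsInward ℓ x v)
    (w : E) : ∀ᶠ T : ℝ in atTop, PointsInward ℓ x (w + T • v) := by
  by_cases h0 : ℓ x = 0 ∧ ℓ ≠ 0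
  · have hv := h h0.1 h0.2
    filter_upwards [eventually_gt_atTop (-ℓ w / ℓ v)] with T hT _ _
    rw [div_lt_iff₀ hv] at hT
    simp only [map_add, map_smul, smul_eq_mul]
    linarith
  · exact .of_forall fun T h1 h2 => (h0 ⟨h1, h2⟩).elim

end Analysis
-- Tangent vectors as velocities of sequences
section Manifold

variable {E H F K M N E' H' P : Type*}
  [NormedAddCommGroup E] [NormedSpace ℝ E] [TopologicalSpace H]
  [NormedAddCommGroup F] [NormedSpace ℝ F] [TopologicalSpace K]
  [TopologicalSpace M] [ChartedSpace H M] [TopologicalSpace N] [ChartedSpace K N]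

/-- The sequence `γ` converges to `p` with velocity `v` (at scale `1 / n`) in the preferred
chart at `p`. -/
def IsTangentSeq (I : ModelWithCorners ℝ E H) (p : M) (γ : ℕ → M) (v : E) : Prop :=
  Tendsto γ atTop (𝓝 p) ∧
    Tendsto (fun n : ℕ => (n : ℝ) • (extChartAt I p (γ n) - extChartAt I p p)) atTop (𝓝 v)

variable {I : ModelWithCorners ℝ E H} {J : ModelWithCorners ℝ F K}

theorem IsTangentSeq.unique {p : M} {γ : ℕ → M} {v w : E} (h : IsTangentSeq I p γ v)
    (h' : IsTangentSeq I p γ w) : v = w :=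
  tendsto_nhds_unique h.2 h'.2

theorem IsTangentSeq.congr {p : M} {γ δ : ℕ → M} {v : E} (h : IsTangentSeq I p γ v)
    (e : ∀ᶠ n in atTop, γ n = δ n) : IsTangentSeq I p δ v :=
  ⟨h.1.congr' e, h.2.congr' (e.mono fun n hn => by rw [hn])⟩

theorem isTangentSeq_const (p : M) : IsTangentSeq I p (fun _ => p) (0 : E) :=
  ⟨tendsto_const_nhds, by simp⟩

theorem IsTangentSeq.prodMk {p : M} {q : N} {γ : ℕ → M} {δ : ℕ → N} {v : E} {w : F}
    (h : IsTangentSeq I p γ v) (h' : IsTangentSeq J q δ w) :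
    IsTangentSeq (I.prod J) (p, q) (fun n => (γ n, δ n)) (v, w) := by
  refine ⟨h.1.prodMk_nhds h'.1, ?_⟩
  rw [extChartAt_prod]
  exact h.2.prodMk_nhds h'.2

/-- A chain rule that needs no unique differentiability of `s`: any derivative within `s` has the
right value on velocities of sequences in `s`. -/
theorem IsTangentSeq.map {f : M → N} {s : Set M} {p : M} {γ : ℕ → M} {v : E} {D : E →L[ℝ] F}
    (h : IsTangentSeq I p γ v) (hD : HasMFDerivWithinAt I J f s p D)
    (hs : ∀ᶠ n in atTop, γ n ∈ s) : IsTangentSeq J (f p) (fun n => f (γ n)) (D v) := by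
  have hsrc := h.1.eventually (extChartAt_source_mem_nhds (I := I) p)
  refine ⟨(Tendsto.comp hD.1 (tendsto_nhdsWithin_iff.2 ⟨h.1, hs⟩) :), ?_⟩
  have hx := tendsto_of_tendsto_natCast_smul_sub h.2
  have hD₂ : HasFDerivWithinAt (E := E) (F := F) (writtenInExtChartAt I J p f) D
    ((extChartAt I p).symm ⁻¹' s ∩ range I) (extChartAt I p p) := hD.2
  have := hD₂.lim (l := atTop) (c := fun n : ℕ => (n : ℝ))
    (d := fun n => extChartAt I p (γ n) - extChartAt I p p) (v := v)
    (by simpa using hx.sub_const (extChartAt I p p)) (by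
      filter_upwards [hs, hsrc] with n h1 h2
      rw [add_sub_cancel]
      refine ⟨?_, mem_range_self _⟩
      rw [mem_preimage, (extChartAt I p).left_inv h2]
      exact h1) h.2
  refine this.congr' ?_
  filter_upwards [hsrc] with n h2
  simp only [add_sub_cancel, writtenInExtChartAt, comp_apply]
  rw [(extChartAt I p).left_inv h2, (extChartAt I p).left_inv (mem_extChartAt_source p)]

theorem isTangentSeq_extChartAt_symm {p : M} {x : ℕ → E} {v : E}
    (hx : Tendsto (fun n : ℕ => (n : ℝ) • (x n - extChartAt I p p)) atTop (𝓝 v))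
    (hr : ∀ᶠ n in atTop, x n ∈ range I) :
    IsTangentSeq I p (fun n => (extChartAt I p).symm (x n)) v := by
  have hx0 := tendsto_of_tendsto_natCast_smul_sub hx
  have hw : Tendsto x atTop (𝓝[range I] (extChartAt I p p)) :=
    tendsto_nhdsWithin_iff.2 ⟨hx0, hr⟩
  have ht := hw.eventually (extChartAt_target_mem_nhdsWithin (I := I) p)
  refine ⟨?_, hx.congr' (ht.mono fun n hn => ?_)⟩
  · have := (continuousAt_extChartAt_symm (I := I) p).tendsto.comp hx0
    rwa [extChartAt_to_inv] at this
  · simp only [(extChartAt I p).right_inv hn]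

variable {ℓ : E →L[ℝ] ℝ}

theorem IsBoundaryModel.extChartAt_nonneg (hI : IsBoundaryModel I ℓ) (p : M) :
    0 ≤ ℓ (extChartAt I p p) :=
  (hI.subset (mem_range_self _) :)

theorem PointsInward.exists_isTangentSeq (hI : IsBoundaryModel I ℓ) {p : M} {v : E}
    (hv : PointsInward ℓ (extChartAt I p p) v) : ∃ γ, IsTangentSeq I p γ v := by
  obtain ⟨r, r0, hr⟩ := hv.exists_closedBall_subset (hI.extChartAt_nonneg p)
  refine ⟨_, isTangentSeq_extChartAt_symm
    (x := fun n => extChartAt I p p + (n : ℝ)⁻¹ • v) ?_ ?_⟩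
  · refine tendsto_const_nhds.congr' ?_
    filter_upwards [eventually_gt_atTop 0] with n hn
    rw [add_sub_cancel_left, smul_inv_smul₀]
    exact_mod_cast hn.ne'
  · filter_upwards [hr] with n h
    rw [hI]
    exact h (mem_closedBall_self (by positivity))

/-- Lifting a tangent sequence through a submersion, with a prescribed inward velocity. -/
theorem PointsInward.exists_lift [CompleteSpace E] [CompleteSpace F] (hI : IsBoundaryModel I ℓ)
    {f : M → N} {p : M} {v : E} (hf : ContMDiffAt I J ∞ f p) {A : E →L[ℝ] F}
    (hA : HasMFDerivAt I J f p A) (hs : Surjective A)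
    (hv : PointsInward ℓ (extChartAt I p p) v) {y : ℕ → N} (hy : IsTangentSeq J (f p) y (A v)) :
    ∃ γ, IsTangentSeq I p γ v ∧ ∀ᶠ n in atTop, f (γ n) = y n := by
  obtain ⟨r, r0, hr⟩ := hv.exists_closedBall_subset (hI.extChartAt_nonneg p)
  rw [← hI] at hr
  have hc := ((contMDiffAt_iff.1 hf).2).of_le (m := 1) (by exact_mod_cast le_top)
  obtain ⟨x, hx, hxy⟩ := exists_lift_of_tendsto (y := fun n => extChartAt J (f p) (y n))
    hc I.convex_range (mem_range_self _) (I.uniqueDiffOn _ (mem_range_self _)) hA.2 hs r0 hr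
    (by simpa only [comp_apply, extChartAt_to_inv] using hy.2)
  have hγ := isTangentSeq_extChartAt_symm (I := I) (p := p) hx (hxy.mono fun n h => h.1)
  refine ⟨_, hγ, ?_⟩
  filter_upwards [hxy, hy.1.eventually (extChartAt_source_mem_nhds (I := J) (f p)),
    (hf.continuousAt.tendsto.comp hγ.1).eventually (extChartAt_source_mem_nhds (I := J) (f p))]
    with n h1 h2 h3
  exact (extChartAt J (f p)).injOn h3 h2 h1.2

/-- A submersion whose restriction to the boundary is a submersion has inward vectors over every
tangent vector of the target. -/
theorem exists_pointsInward (hI : IsBoundaryModel I ℓ) {p : M} {A : E →L[ℝ] F} (hs : Surjective A)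
    (hb : p ∈ I.boundary M → ∀ w, ∃ v, ℓ v = 0 ∧ A v = w) (w : F) :
    ∃ v, PointsInward ℓ (extChartAt I p p) v ∧ A v = w := by
  by_cases h0 : ℓ (extChartAt I p p) = 0 ∧ ℓ ≠ 0
  · obtain ⟨e, he⟩ : ∃ e, 0 < ℓ e := by
      obtain ⟨e, he⟩ := DFunLike.ne_iff.1 h0.2
      rcases lt_or_gt_of_ne he with h | h
      · exact ⟨-e, by simpa using h⟩
      · exact ⟨e, by simpa using h⟩
    -- Moving from a point with `ℓ = 0` in direction `-e` leaves the half-space at once.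
    have hbd : p ∈ I.boundary M := by
      refine ⟨subset_closure (mem_range_self _), fun hint => ?_⟩
      have hc : Tendsto (fun τ : ℝ => extChartAt I p p - τ • e) (𝓝[>] 0)
          (𝓝 (extChartAt I p p)) := by
        have : Continuous fun τ : ℝ => extChartAt I p p - τ • e := by fun_prop
        simpa using (this.tendsto 0).mono_left nhdsWithin_le_nhds
      obtain ⟨τ, h1, h2⟩ := ((hc.eventually (mem_interior_iff_mem_nhds.1 hint)).and
        self_mem_nhdsWithin).exists
      have h3 : 0 ≤ ℓ (extChartAt I p p - τ • e) := hI.subset h1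
      rw [map_sub, h0.1, map_smul, smul_eq_mul] at h3
      nlinarith [mul_pos (show 0 < τ from h2) he]
    -- Adding `e` to a lift tangent to the boundary makes it inward; lifting `w - A e` compensates
    -- for this.
    obtain ⟨v, hv, hw⟩ := hb hbd (w - A e)
    exact ⟨v + e, fun _ _ => by rw [map_add, hv]; simpa using he, by rw [map_add, hw]; simp⟩
  · obtain ⟨v, hv⟩ := hs w
    exact ⟨v, fun h1 h2 => (h0 ⟨h1, h2⟩).elim, hv⟩

end Manifold
/-- A linear map vanishing on those vectors of a subspace which satisfy a condition `P` vanishes on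
the subspace, if some `v₀` in it dominates every vector with respect to `P`. -/
theorem LinearMap.eq_zero_of_eventually {V G : Type*} [AddCommGroup V] [Module ℝ V]
    [AddCommGroup G] [Module ℝ G] (W : Submodule ℝ V) (P : V → Prop) (L : V →ₗ[ℝ] G) {v₀ : V}
    (h₀ : v₀ ∈ W) (hP : ∀ w, ∀ᶠ T : ℝ in atTop, P (w + T • v₀))
    (hL : ∀ v ∈ W, P v → L v = 0) {v : V} (hv : v ∈ W) : L v = 0 := by
  obtain ⟨T, h1, h2⟩ := ((hP v).and (hP 0)).exists
  have e1 := hL _ (W.add_mem hv (W.smul_mem T h₀)) h1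
  have e2 := hL _ (W.add_mem W.zero_mem (W.smul_mem T h₀)) h2
  rw [zero_add] at e2
  rwa [map_add, e2, add_zero] at e1

/-! ### Differentials of the structure maps of a Lie category -/

namespace ArrowCategory

/-- The opposite category. -/
def op {C X : Type*} (𝒞 : ArrowCategory C X) : ArrowCategory C X where
  s := 𝒞.t
  t := 𝒞.s
  u := 𝒞.u
  comp g h := 𝒞.comp h g
  s_u := 𝒞.t_u
  t_u := 𝒞.s_u
  s_comp g h e := 𝒞.t_comp h g e.symm
  t_comp g h e := 𝒞.s_comp h g e.symm
  comp_u := 𝒞.u_comp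
  u_comp := 𝒞.comp_u
  assoc g h k e e' := (𝒞.assoc k h g e'.symm e.symm).symm

variable {E H F K C X : Type*}
  [NormedAddCommGroup E] [NormedSpace ℝ E] [TopologicalSpace H]
  [NormedAddCommGroup F] [NormedSpace ℝ F] [TopologicalSpace K]
  [TopologicalSpace C] [ChartedSpace H C] [TopologicalSpace X] [ChartedSpace K X]

section Derivatives

variable (I : ModelWithCorners ℝ E H) (J : ModelWithCorners ℝ F K) (𝒞 : ArrowCategory C X)

/-- The differential of the source map, on the model space. -/
noncomputable def sourceDeriv (g : C) : E →L[ℝ] F := mfderiv I J 𝒞.s g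

/-- The differential of the target map, on the model space. -/
noncomputable def targetDeriv (g : C) : E →L[ℝ] F := mfderiv I J 𝒞.t g

/-- The differential of the composition map, on the model space. -/
noncomputable def compDeriv (g h : C) : E × E →L[ℝ] E :=
  mfderivWithin (I.prod I) I (fun p : C × C => 𝒞.comp p.1 p.2) 𝒞.composable (g, h)

/-- The left differential, expressed through the differential of the composition map. -/
noncomputable def leftMap (g h : C) :
    LinearMap.ker (𝒞.targetDeriv I J h).toLinearMap →ₗ[ℝ] E :=
  ((𝒞.compDeriv I g h).toLinearMap ∘ₗ LinearMap.inr ℝ E E).domRestrict _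

end Derivatives

namespace IsLieCategory

variable {I : ModelWithCorners ℝ E H} {J : ModelWithCorners ℝ F K} {ℓ : E →L[ℝ] ℝ}
  {𝒞 : ArrowCategory C X}

/-- Duality turns statements on sources into statements on targets, and left ranks into right ranks.
-/
theorem op (hC : 𝒞.IsLieCategory I ℓ J) : 𝒞.op.IsLieCategory I ℓ J where
  smooth_s := hC.smooth_t
  smooth_t := hC.smooth_s
  submersion_s := hC.submersion_t
  submersion_t := hC.submersion_s
  smooth_u := hC.smooth_u
  smooth_comp := hC.smooth_comp.comp
    (contMDiff_snd.prodMk contMDiff_fst).contMDiffOn (fun _ hp => Eq.symm hp)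
  boundary_submersion_s := hC.boundary_submersion_t
  boundary_submersion_t := hC.boundary_submersion_s

theorem hasMFDerivAt_s (hC : 𝒞.IsLieCategory I ℓ J) (g : C) :
    HasMFDerivAt I J 𝒞.s g (𝒞.sourceDeriv (E := E) (F := F) I J g) :=
  ((hC.smooth_s g).mdifferentiableAt (by simp)).hasMFDerivAt

theorem surjective_sourceDeriv (hC : 𝒞.IsLieCategory I ℓ J) (g : C) :
    Surjective (𝒞.sourceDeriv I J g) :=
  hC.submersion_s g

theorem mdifferentiableWithinAt_comp (hC : 𝒞.IsLieCategory I ℓ J) {g h : C} (e : 𝒞.s g = 𝒞.t h) :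
    MDifferentiableWithinAt (I.prod I) I (fun p : C × C => 𝒞.comp p.1 p.2) 𝒞.composable (g, h) :=
  (hC.smooth_comp (g, h) e).mdifferentiableWithinAt (by simp)

theorem exists_pointsInward_s (hC : 𝒞.IsLieCategory I ℓ J) (hI : IsBoundaryModel I ℓ) (g : C)
    (w : F) : ∃ v, PointsInward ℓ (extChartAt I g g) v ∧ 𝒞.sourceDeriv I J g v = w :=
  exists_pointsInward hI (hC.surjective_sourceDeriv g) (hC.boundary_submersion_s g) w

theorem isTangentSeq_s (hC : 𝒞.IsLieCategory I ℓ J) {g : C} {γ : ℕ → C} {v : E}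
    (h : IsTangentSeq I g γ v) :
    IsTangentSeq J (𝒞.s g) (fun n => 𝒞.s (γ n)) (𝒞.sourceDeriv I J g v) :=
  h.map (hC.hasMFDerivAt_s g).hasMFDerivWithinAt (s := univ) (by simp)

theorem isTangentSeq_t (hC : 𝒞.IsLieCategory I ℓ J) {g : C} {γ : ℕ → C} {v : E}
    (h : IsTangentSeq I g γ v) :
    IsTangentSeq J (𝒞.t g) (fun n => 𝒞.t (γ n)) (𝒞.targetDeriv I J g v) :=
  hC.op.isTangentSeq_s h

theorem isTangentSeq_comp (hC : 𝒞.IsLieCategory I ℓ J) {g h : C} (e : 𝒞.s g = 𝒞.t h)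
    {α β : ℕ → C} {a b : E} (ha : IsTangentSeq I g α a) (hb : IsTangentSeq I h β b)
    (hαβ : ∀ᶠ n in atTop, 𝒞.s (α n) = 𝒞.t (β n)) :
    IsTangentSeq I (𝒞.comp g h) (fun n => 𝒞.comp (α n) (β n)) (𝒞.compDeriv I g h (a, b)) :=
  (ha.prodMk hb).map (hC.mdifferentiableWithinAt_comp e).hasMFDerivWithinAt hαβ

variable [FiniteDimensional ℝ E] [FiniteDimensional ℝ F]

theorem exists_lift_s (hC : 𝒞.IsLieCategory I ℓ J) (hI : IsBoundaryModel I ℓ) {g : C} {v : E}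
    (hv : PointsInward ℓ (extChartAt I g g) v) {y : ℕ → X}
    (hy : IsTangentSeq J (𝒞.s g) y (𝒞.sourceDeriv I J g v)) :
    ∃ γ, IsTangentSeq I g γ v ∧ ∀ᶠ n in atTop, 𝒞.s (γ n) = y n :=
  haveI := FiniteDimensional.complete ℝ E
  haveI := FiniteDimensional.complete ℝ F
  hv.exists_lift hI (hC.smooth_s g) (hC.hasMFDerivAt_s g) (hC.surjective_sourceDeriv g) hy

theorem exists_lift_t (hC : 𝒞.IsLieCategory I ℓ J) (hI : IsBoundaryModel I ℓ) {g : C} {v : E}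
    (hv : PointsInward ℓ (extChartAt I g g) v) {y : ℕ → X}
    (hy : IsTangentSeq J (𝒞.t g) y (𝒞.targetDeriv I J g v)) :
    ∃ γ, IsTangentSeq I g γ v ∧ ∀ᶠ n in atTop, 𝒞.t (γ n) = y n :=
  hC.op.exists_lift_s hI hv hy

/-! ### Differentiating the category laws -/

/-- Vectors in a source fibre are represented by sequences in it, up to linear combinations. -/
theorem eq_zero_of_source (hC : 𝒞.IsLieCategory I ℓ J) (hI : IsBoundaryModel I ℓ) {h : C}
    (L : E →ₗ[ℝ] E)
    (hL : ∀ γ v, IsTangentSeq I h γ v → (∀ᶠ n in atTop, 𝒞.s (γ n) = 𝒞.s h) → L v = 0) {v : E}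
    (hv : 𝒞.sourceDeriv I J h v = 0) : L v = 0 := by
  obtain ⟨v₀, h₀, h₁⟩ := hC.exists_pointsInward_s hI h 0
  refine LinearMap.eq_zero_of_eventually (LinearMap.ker (𝒞.sourceDeriv I J h).toLinearMap)
    (PointsInward ℓ (extChartAt I h h)) L (v₀ := v₀) h₁ h₀.eventually_add_smul
    (fun w hw hP => ?_) hv
  have hw' : 𝒞.sourceDeriv I J h w = 0 := hw
  obtain ⟨γ, hγ, hs⟩ := hC.exists_lift_s hI hP (y := fun _ => 𝒞.s h)
    (by rw [hw']; exact isTangentSeq_const _)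
  exact hL γ w hγ hs

theorem compDeriv_unit (hC : 𝒞.IsLieCategory I ℓ J) (hI : IsBoundaryModel I ℓ) {h : C} {v : E}
    (hv : 𝒞.sourceDeriv I J h v = 0) : 𝒞.compDeriv I h (𝒞.u (𝒞.s h)) (v, 0) = v := by
  refine sub_eq_zero.1 (hC.eq_zero_of_source hI ((𝒞.compDeriv I h (𝒞.u (𝒞.s h))).toLinearMap ∘ₗ
    LinearMap.inl ℝ E E - LinearMap.id) (fun γ w hγ hs => sub_eq_zero.2 ?_) hv)
  have h1 := hC.isTangentSeq_comp (𝒞.t_u _).symm hγ (isTangentSeq_const (𝒞.u (𝒞.s h)))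
    (hs.mono fun n hn => by rw [hn, 𝒞.t_u])
  rw [𝒞.comp_u] at h1
  exact h1.unique (hγ.congr (hs.mono fun n hn => by rw [← hn, 𝒞.comp_u]))

/-- Both sides give the velocity of `g γₙ` for sequences `γ` in the target fibre. -/
theorem leftDifferential_apply (hC : 𝒞.IsLieCategory I ℓ J) (hI : IsBoundaryModel I ℓ) {g h : C}
    (e : 𝒞.s g = 𝒞.t h) {v : E} (hv : 𝒞.targetDeriv I J h v = 0) :
    (mfderivWithin I I (𝒞.leftTranslation g) (𝒞.targetFibre (𝒞.s g)) h : E →L[ℝ] E) v =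
      𝒞.compDeriv I g h (0, v) := by
  have hd : MDifferentiableWithinAt I I (𝒞.leftTranslation g) (𝒞.targetFibre (𝒞.s g)) h :=
    (hC.mdifferentiableWithinAt_comp e).comp h (f := fun k => (g, k))
      (mdifferentiableWithinAt_const.prodMk mdifferentiableWithinAt_id) (fun k hk => Eq.symm hk)
  let D : E →L[ℝ] E := mfderivWithin I I (𝒞.leftTranslation g) (𝒞.targetFibre (𝒞.s g)) h
  refine sub_eq_zero.1 (hC.op.eq_zero_of_source hI (D.toLinearMap - (𝒞.compDeriv I g h).toLinearMap ∘ₗ LinearMap.inr ℝ E E)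
    (fun γ w hγ hs => sub_eq_zero.2 ?_) hv)
  have hs' : ∀ᶠ n in atTop, 𝒞.t (γ n) = 𝒞.s g := hs.mono fun n hn => hn.trans e.symm
  exact (hγ.map hd.hasMFDerivWithinAt hs').unique
    (hC.isTangentSeq_comp e (isTangentSeq_const g) hγ (hs'.mono fun n hn => hn.symm))

/-- An identity between the differentials at a composable triple holds for all composable triples of
tangent vectors if it holds for those which are represented by sequences of composable triples. -/
theorem eq_zero_of_composable_triple (hC : 𝒞.IsLieCategory I ℓ J) (hI : IsBoundaryModel I ℓ)
    {g h k : C} (e : 𝒞.s g = 𝒞.t h) (e' : 𝒞.s h = 𝒞.t k) {G : Type*} [AddCommGroup G] [Module ℝ G]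
    (L : E × E × E →ₗ[ℝ] G)
    (hL : ∀ α β γ a b c, IsTangentSeq I g α a → IsTangentSeq I h β b → IsTangentSeq I k γ c →
      (∀ᶠ n in atTop, 𝒞.s (α n) = 𝒞.t (β n)) → (∀ᶠ n in atTop, 𝒞.s (β n) = 𝒞.t (γ n)) →
      L (a, b, c) = 0) {a b c : E}
    (hab : 𝒞.sourceDeriv I J g a = 𝒞.targetDeriv I J h b)
    (hbc : 𝒞.sourceDeriv I J h b = 𝒞.targetDeriv I J k c) : L (a, b, c) = 0 := by
  obtain ⟨b₀, hb₀, -⟩ := hC.exists_pointsInward_s hI h 0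
  obtain ⟨a₀, ha₀, hab₀⟩ := hC.exists_pointsInward_s hI g (𝒞.targetDeriv I J h b₀)
  obtain ⟨c₀, hc₀, hbc₀⟩ := hC.op.exists_pointsInward_s hI k (𝒞.sourceDeriv I J h b₀)
  let W : Submodule ℝ (E × E × E) :=
    { carrier := {v | 𝒞.sourceDeriv I J g v.1 = 𝒞.targetDeriv I J h v.2.1 ∧
        𝒞.sourceDeriv I J h v.2.1 = 𝒞.targetDeriv I J k v.2.2}
      add_mem' := fun {v w} hv hw => by
        simp only [mem_ofPred_eq, Prod.fst_add, Prod.snd_add, map_add] at hv hw ⊢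
        rw [hv.1, hv.2, hw.1, hw.2]
        exact ⟨rfl, rfl⟩
      zero_mem' := by simp
      smul_mem' := fun r v hv => by
        simp only [mem_ofPred_eq, Prod.smul_fst, Prod.smul_snd, map_smul] at hv ⊢
        rw [hv.1, hv.2]
        exact ⟨rfl, rfl⟩ }
  refine LinearMap.eq_zero_of_eventually W (fun v => PointsInward ℓ (extChartAt I g g) v.1 ∧
    PointsInward ℓ (extChartAt I h h) v.2.1 ∧ PointsInward ℓ (extChartAt I k k) v.2.2) L
    (v₀ := (a₀, b₀, c₀)) ⟨hab₀, hbc₀.symm⟩ (fun w => (ha₀.eventually_add_smul w.1).and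
    ((hb₀.eventually_add_smul w.2.1).and (hc₀.eventually_add_smul w.2.2))) ?_
    (show (a, b, c) ∈ W from ⟨hab, hbc⟩)
  rintro ⟨a, b, c⟩ ⟨hab, hbc⟩ ⟨ha, hb, hc⟩
  -- The middle factor is chosen freely; each outer factor then has one constraint, met by lifting
  -- through `s` or `t`.
  obtain ⟨β, hβ⟩ := hb.exists_isTangentSeq hI
  obtain ⟨α, hα, hαβ⟩ := hC.exists_lift_s hI ha (y := fun n => 𝒞.t (β n))
    (by rw [e, hab]; exact hC.isTangentSeq_t hβ)
  obtain ⟨γ, hγ, hβγ⟩ := hC.exists_lift_t hI hc (y := fun n => 𝒞.s (β n))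
    (by rw [← e', ← hbc]; exact hC.isTangentSeq_s hβ)
  exact hL α β γ a b c hα hβ hγ hαβ (hβγ.mono fun n hn => hn.symm)

/-- The differential of the associativity law. -/
theorem compDeriv_assoc (hC : 𝒞.IsLieCategory I ℓ J) (hI : IsBoundaryModel I ℓ)
    {g h k : C} (e : 𝒞.s g = 𝒞.t h) (e' : 𝒞.s h = 𝒞.t k) {a b c : E}
    (hab : 𝒞.sourceDeriv I J g a = 𝒞.targetDeriv I J h b)
    (hbc : 𝒞.sourceDeriv I J h b = 𝒞.targetDeriv I J k c) :
    𝒞.compDeriv I (𝒞.comp g h) k (𝒞.compDeriv I g h (a, b), c) =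
      𝒞.compDeriv I g (𝒞.comp h k) (a, 𝒞.compDeriv I h k (b, c)) := by
  let p₁ := LinearMap.fst ℝ E (E × E)
  let p₂ := LinearMap.fst ℝ E E ∘ₗ LinearMap.snd ℝ E (E × E)
  let p₃ := LinearMap.snd ℝ E E ∘ₗ LinearMap.snd ℝ E (E × E)
  refine sub_eq_zero.1 (hC.eq_zero_of_composable_triple hI e e'
    ((𝒞.compDeriv I (𝒞.comp g h) k).toLinearMap ∘ₗ
        ((𝒞.compDeriv I g h).toLinearMap ∘ₗ p₁.prod p₂).prod p₃ -
      (𝒞.compDeriv I g (𝒞.comp h k)).toLinearMap ∘ₗ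
        p₁.prod ((𝒞.compDeriv I h k).toLinearMap ∘ₗ p₂.prod p₃))
    (fun α β γ a b c hα hβ hγ h₁ h₂ => sub_eq_zero.2 ?_) hab hbc)
  have h3 := hC.isTangentSeq_comp ((𝒞.s_comp g h e).trans e') (hC.isTangentSeq_comp e hα hβ h₁) hγ
    (by filter_upwards [h₁, h₂] with n h₁ h₂; rw [𝒞.s_comp _ _ h₁, h₂])
  have h4 := hC.isTangentSeq_comp (e.trans (𝒞.t_comp h k e').symm) hα
    (hC.isTangentSeq_comp e' hβ hγ h₂)
    (by filter_upwards [h₁, h₂] with n h₁ h₂; rw [𝒞.t_comp _ _ h₂, h₁])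
  rw [𝒞.assoc g h k e e'] at h3
  exact (h3.congr (by filter_upwards [h₁, h₂] with n h₁ h₂; rw [𝒞.assoc _ _ _ h₁ h₂])).unique h4

theorem sourceDeriv_compDeriv (hC : 𝒞.IsLieCategory I ℓ J) (hI : IsBoundaryModel I ℓ)
    {g h : C} (e : 𝒞.s g = 𝒞.t h) {a b : E}
    (hab : 𝒞.sourceDeriv I J g a = 𝒞.targetDeriv I J h b) :
    𝒞.sourceDeriv I J (𝒞.comp g h) (𝒞.compDeriv I g h (a, b)) = 𝒞.sourceDeriv I J h b := by
  -- The pair is padded to a composable triple by a vector at the unit of `s h`, on which the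
  -- identity does not depend.
  obtain ⟨c, -, hbc⟩ := hC.op.exists_pointsInward_s hI (𝒞.u (𝒞.s h)) (𝒞.sourceDeriv I J h b)
  refine sub_eq_zero.1 (hC.eq_zero_of_composable_triple hI e (𝒞.t_u (𝒞.s h)).symm
    ((((𝒞.sourceDeriv I J (𝒞.comp g h)).comp (𝒞.compDeriv I g h)).toLinearMap -
      (𝒞.sourceDeriv I J h).toLinearMap ∘ₗ LinearMap.snd ℝ E E) ∘ₗ
      (LinearMap.fst ℝ E (E × E)).prod (LinearMap.fst ℝ E E ∘ₗ LinearMap.snd ℝ E (E × E)))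
    (fun α β γ a b c hα hβ _ h₁ _ => sub_eq_zero.2 ?_) hab hbc.symm)
  have h2 := hC.isTangentSeq_s (hC.isTangentSeq_comp e hα hβ h₁)
  rw [𝒞.s_comp g h e] at h2
  exact (h2.congr (h₁.mono fun n hn => 𝒞.s_comp _ _ hn)).unique (hC.isTangentSeq_s hβ)

theorem targetDeriv_compDeriv (hC : 𝒞.IsLieCategory I ℓ J) (hI : IsBoundaryModel I ℓ)
    {g h : C} (e : 𝒞.s g = 𝒞.t h) {a b : E}
    (hab : 𝒞.sourceDeriv I J g a = 𝒞.targetDeriv I J h b) :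
    𝒞.targetDeriv I J (𝒞.comp g h) (𝒞.compDeriv I g h (a, b)) = 𝒞.targetDeriv I J g a := by
  obtain ⟨c, -, hbc⟩ := hC.op.exists_pointsInward_s hI (𝒞.u (𝒞.s h)) (𝒞.sourceDeriv I J h b)
  refine sub_eq_zero.1 (hC.eq_zero_of_composable_triple hI e (𝒞.t_u (𝒞.s h)).symm
    ((((𝒞.targetDeriv I J (𝒞.comp g h)).comp (𝒞.compDeriv I g h)).toLinearMap -
      (𝒞.targetDeriv I J g).toLinearMap ∘ₗ LinearMap.fst ℝ E E) ∘ₗ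
      (LinearMap.fst ℝ E (E × E)).prod (LinearMap.fst ℝ E E ∘ₗ LinearMap.snd ℝ E (E × E)))
    (fun α β γ a b c hα hβ _ h₁ _ => sub_eq_zero.2 ?_) hab hbc.symm)
  have h2 := hC.isTangentSeq_t (hC.isTangentSeq_comp e hα hβ h₁)
  rw [𝒞.t_comp g h e] at h2
  exact (h2.congr (h₁.mono fun n hn => 𝒞.t_comp _ _ hn)).unique (hC.isTangentSeq_t hα)

/-! ### Comparison of kernels and ranks -/

/-- If `k` has a right inverse, right translation by `k` embeds the kernel of the differential of
`L_g` at `h` into the kernel of its differential at `hk`. -/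
theorem finrank_ker_leftMap_le (hC : 𝒞.IsLieCategory I ℓ J) (hI : IsBoundaryModel I ℓ)
    {g h k k' : C} (e : 𝒞.s g = 𝒞.t h) (e₁ : 𝒞.s h = 𝒞.t k) (e₂ : 𝒞.s k = 𝒞.t k')
    (hk : 𝒞.comp k k' = 𝒞.u (𝒞.s h)) :
    Module.finrank ℝ (LinearMap.ker (𝒞.leftMap I J g h)) ≤
      Module.finrank ℝ (LinearMap.ker (𝒞.leftMap I J g (𝒞.comp h k))) := by
  have hz : ∀ v : LinearMap.ker (𝒞.leftMap I J g h), 𝒞.compDeriv I g h (0, (v : E)) = 0 :=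
    fun v => v.2
  have ht : ∀ v : LinearMap.ker (𝒞.leftMap I J g h), 𝒞.targetDeriv I J h (v : E) = 0 :=
    fun v => v.1.2
  -- From `s(gh) = s(h)`; this makes `(v, 0)` a composable tangent pair at `(h, k)`.
  have hs : ∀ v : LinearMap.ker (𝒞.leftMap I J g h), 𝒞.sourceDeriv I J h (v : E) = 0 := fun v => by
    have := hC.sourceDeriv_compDeriv hI e (a := 0) (b := (v : E)) (by rw [ht, map_zero])
    rw [← this, hz, map_zero]
  let φ : LinearMap.ker (𝒞.leftMap I J g h) →ₗ[ℝ] E :=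
    (𝒞.compDeriv I h k).toLinearMap ∘ₗ LinearMap.inl ℝ E E ∘ₗ
      Submodule.subtype _ ∘ₗ Submodule.subtype _
  have hφ : ∀ v, φ v = 𝒞.compDeriv I h k ((v : E), 0) := fun v => rfl
  have hsv : ∀ v : LinearMap.ker (𝒞.leftMap I J g h),
      𝒞.sourceDeriv I J h (v : E) = 𝒞.targetDeriv I J k 0 := fun v => by rw [hs, map_zero]
  have h1 : ∀ v, φ v ∈ LinearMap.ker (𝒞.targetDeriv I J (𝒞.comp h k)).toLinearMap := fun v =>
    (hC.targetDeriv_compDeriv hI e₁ (hsv v)).trans (ht v)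
  refine LinearMap.finrank_le_finrank_of_injective
    (f := (φ.codRestrict _ h1).codRestrict _ fun v => ?_) fun v w hvw => ?_
  · show 𝒞.compDeriv I g (𝒞.comp h k) (0, φ v) = 0
    rw [hφ, ← hC.compDeriv_assoc hI e e₁ (by rw [ht, map_zero]) (hsv v), hz]
    exact map_zero _
  · have hvw' : φ v = φ w := congrArg (fun x : LinearMap.ker
      (𝒞.leftMap I J g (𝒞.comp h k)) => (x : E)) hvw
    -- Injectivity: `(v·k)·k' = v·(k k') = v`.
    have key : ∀ v : LinearMap.ker (𝒞.leftMap I J g h),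
        𝒞.compDeriv I (𝒞.comp h k) k' (φ v, 0) = (v : E) := fun v => by
      rw [hφ, hC.compDeriv_assoc hI e₁ e₂ (hsv v) (by simp), Prod.mk_zero_zero, map_zero, hk,
        hC.compDeriv_unit hI (hs v)]
    exact Subtype.ext (Subtype.ext (by rw [← key v, hvw', key w]))

/-- Rank-nullity for `d(L_g)_h` on `ker dt` and for the surjection `dt`: the rank depends on `h`
only through the nullity. -/
theorem finrank_range_leftDifferential (hC : 𝒞.IsLieCategory I ℓ J) (hI : IsBoundaryModel I ℓ)
    {g h : C} (e : 𝒞.s g = 𝒞.t h) :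
    Module.finrank ℝ (LinearMap.range (𝒞.leftDifferential I J g h)) +
      Module.finrank ℝ (LinearMap.ker (𝒞.leftMap I J g h)) + Module.finrank ℝ F =
      Module.finrank ℝ E := by
  have h1 : 𝒞.leftDifferential I J g h = 𝒞.leftMap I J g h :=
    LinearMap.ext fun v => hC.leftDifferential_apply hI e v.2
  have h2 : Module.finrank ℝ (LinearMap.range (𝒞.leftDifferential I J g h)) =
      Module.finrank ℝ (LinearMap.range (𝒞.leftMap I J g h)) :=
    congrArg (fun f : LinearMap.ker (𝒞.targetDeriv I J h).toLinearMap →ₗ[ℝ] E =>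
      Module.finrank ℝ (LinearMap.range f)) h1
  have h3 := (𝒞.targetDeriv I J h).toLinearMap.finrank_range_add_finrank_ker
  have h4 : Surjective (𝒞.targetDeriv I J h) := hC.submersion_t h
  rw [LinearMap.range_eq_top.2 h4, finrank_top] at h3
  rw [h2, LinearMap.finrank_range_add_finrank_ker, add_comm, h3]

theorem leftRank_eq (hC : 𝒞.IsLieCategory I ℓ J) (hI : IsBoundaryModel I ℓ) {g h : C}
    (hh : h ∈ 𝒞.core) (e : 𝒞.t h = 𝒞.s g) :
    𝒞.leftRank I J g = Module.finrank ℝ (LinearMap.range (𝒞.leftDifferential I J g h)) := by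
  obtain ⟨k, hk₁, hk₂, hk₃, hk₄⟩ := hh
  have h1 := hC.finrank_range_leftDifferential hI e.symm
  have h2 := hC.finrank_range_leftDifferential hI (𝒞.t_u (𝒞.s g)).symm
  -- Translation by the inverse `k` goes from `h` to the unit; translation by `h` (`h4`) goes back.
  have h3 := hC.finrank_ker_leftMap_le hI e.symm hk₂.symm hk₁ hk₃
  rw [hk₄, e] at h3
  have h4 := hC.finrank_ker_leftMap_le hI (𝒞.t_u (𝒞.s g)).symm (by rw [𝒞.s_u, e]) hk₂.symm
    (by rw [hk₄, 𝒞.s_u, e])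
  rw [← e, 𝒞.u_comp, e] at h4
  rw [leftRank]
  omega

end IsLieCategory

end ArrowCategory

theorem mainTheorem9
    {E H F K C X : Type*}
    [NormedAddCommGroup E] [NormedSpace ℝ E] [FiniteDimensional ℝ E] [TopologicalSpace H]
    [NormedAddCommGroup F] [NormedSpace ℝ F] [FiniteDimensional ℝ F] [TopologicalSpace K]
    (I : ModelWithCorners ℝ E H) (ℓ : E →L[ℝ] ℝ) (hI : IsBoundaryModel I ℓ)
    (J : ModelWithCorners ℝ F K) [J.Boundaryless]
    [TopologicalSpace C] [T2Space C] [SecondCountableTopology C]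
    [ChartedSpace H C] [IsManifold I ∞ C]
    [TopologicalSpace X] [T2Space X] [SecondCountableTopology X]
    [ChartedSpace K X] [IsManifold J ∞ X]
    (𝒞 : ArrowCategory C X) (hC : 𝒞.IsLieCategory I ℓ J) (hN : 𝒞.HasNormalBoundary I) (g : C) :
    (∀ h ∈ 𝒞.core ∩ 𝒞.targetFibre (𝒞.s g),
      𝒞.leftRank I J g = Module.finrank ℝ (LinearMap.range (𝒞.leftDifferential I J g h))) ∧
    (∀ h ∈ 𝒞.core ∩ 𝒞.sourceFibre (𝒞.t g),
      𝒞.rightRank I J g = Module.finrank ℝ (LinearMap.range (𝒞.rightDifferential I J g h))) := by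
  -- The right-hand statement is the left-hand one in the opposite category, where the two equations
  -- for an inverse swap.
  exact ⟨fun h hh => hC.leftRank_eq hI hh.1 hh.2, fun h hh => hC.op.leftRank_eq hI
    (by obtain ⟨k, h1, h2, h3, h4⟩ := hh.1; exact ⟨k, h2, h1, h4, h3⟩) hh.2⟩
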